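/- Setting. A graph $X=(V,E)$ consists of vertices, oriented edges, a fixed-point free involution $e\mapsto\bar e$ of $E$ and maps $e\mapsto e_\pm\in V$ with $\bar e_+=e_-$. Let $X$ be a finite connected graph, let $n\ge 0$, and let $(\mathcal G,X)$ be a graph of groups on $X$ all of whose vertex and edge groups are $\mathbb Z^n$, the monomorphism $\mathcal G_e\to \mathcal G_{e_+}$ being given by an integer matrix $\sigma_e$ with $\det\sigma_e\ne 0$. Fix a maximal tree $T$ in $X$, an orientation $A$ of $X$ and a base vertex $v_0$. Let $G=\pi_1(\mathcal G,X,T)$ be the Bass–Serre fundamental group: the quotient of the free product of the vertex groups and of the free group on $(t_e)_{e\in E}$ by the relations $t_e\sigma_e(g)t_e^{-1}=\sigma_{\bar e}(g)$ and $t_et_{\bar e}=1$ ($e\in E$, $g\in\mathbb Z^n$) and $t_e=1$ ($e\in T$). Let $G_v\subset G$ be the image of the vertex group at $v$ and $G_e\subset G_{e_+}$ the image of $\sigma_e(\mathbb Z^n)$. Let $\tilde X$ be the Bass–Serre tree, with vertex set $\coprod_v G/G_v$, edge set $\coprod_e G/G_e$, $(gG_e)_+=gG_{e_+}$, $\overline{gG_e}=gt_e^{-1}G_{\bar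 e}$ and $(gG_e)_-=gt_e^{-1}G_{e_-}$; let $\mathrm{Aut}(\tilde X)$ have the topology of pointwise convergence, and let $\iota:G\to\mathrm{Aut}(\tilde X)$ be the action by left translations. Let $H_d\subset G$ be the subgroup generated by the $t_e$, $e\in A\smallsetminus T$, with the discrete topology, and let $\varphi:G\to H_d$ be the homomorphism which is trivial on all $G_v$ and satisfies $\varphi(t_e)=t_e$. It extends uniquely to a continuous homomorphism $\bar\varphi:\overline{\iota(G)}\to H_d$ with $\bar\varphi\circ\iota=\varphi$. For $v\in V$, let $e_1,\dots,e_k$ be the edges, oriented from $v_0$ to $v$, of the geodesic from $v_0$ to $v$ in $T$, and put $\tau_v=\prod_{i=1}^k\sigma_{\bar e_i}\sigma_{e_i}^{-1}$ (ordered product). Let $\mu:G\to\mathbb R^n\rtimes \mathrm{GL}_n(\mathbb R)$ be the homomorphism given by the translation by $\tau_v g$ for $g$ in the vertex group at $v$, and by $\mu(t_e)=\tau_{e_-}\sigma_{\bar e}\sigma_e^{-1}\tau_{e_+}^{-1}\in\mathrm{GL}_n(\mathbb R)$. Let $H_d$ act on $\mathbb R^n$ through $\mu$, let $\nu:G\to\mathbb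 R^n\rtimes_\mu H_d$ be the homomorphism whose $\mathbb R^n$-component is that of $\mu$ and whose $H_d$-component is $\varphi$, let $\psi:\mathbb R^n\rtimes_\mu H_d\to H_d$ be the projection, and put $$W=\{(g,h)\in\overline{\iota(G)}\times(\mathbb R^n\rtimes_\mu H_d):\ \bar\varphi(g)=\psi(h)\}.$$ Proposition. The homomorphism $\iota\times\nu:G\to\mathrm{Aut}(\tilde X)\times(\mathbb R^n\rtimes_\mu H_d)$ is injective; its image is contained in $W$ and is a cocompact lattice in $W$, that is, a discrete subgroup of $W$ such that the quotient of $W$ by it is compact. Moreover the homomorphism $\iota\times\mu:G\to\mathrm{Aut}(\tilde X)\times(\mathbb R^n\rtimes\mathrm{GL}_n(\mathbb R))$ is proper, i.e. the preimage of every compact set is finite; a fortiori so is $G\to\overline{\iota(G)}\times(\mathbb R^n\rtimes\mu(H_d))$. -/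

import Mathlib

open Topology

noncomputable section

namespace GraphZn

/-! ### Graphs, walks, maximal trees, orientations -/

/-- A graph with vertex set `V` and set of oriented edges `E`: a fixed-point free involution
`bar` on `E` and the extremity map `plus`; the origin of `e` is the extremity of `bar e`.
Loops and multiple edges are allowed. -/
structure OGraph (V : Type*) (E : Type*) where
  bar : E → E
  plus : E → V
  bar_bar : ∀ e, bar (bar e) = e
  bar_ne : ∀ e, bar e ≠ e

namespace OGraph

variable {V E : Type*} (X : OGraph V E)

/-- The origin of an oriented edge. -/
def minus (e : E) : V := X.plus (X.bar e)

/-- `X.IsWalk v p w`: the list of oriented edges `p` is a path from `v` to `w`. -/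
def IsWalk : V → List E → V → Prop
  | v, [], w => v = w
  | v, e :: p, w => X.minus e = v ∧ IsWalk (X.plus e) p w

/-- A path without backtracking. -/
def IsReduced (p : List E) : Prop := p.IsChain (fun e f => f ≠ X.bar e)

/-- The graph is non-empty, and any two vertices are joined by a path. -/
def IsConnected : Prop := Nonempty V ∧ ∀ v w, ∃ p, X.IsWalk v p w

/-- A maximal tree of a connected graph, given by its set of (oriented) edges: a subgraph which
contains all vertices and in which any two vertices are joined by exactly one path without
backtracking. -/
structure MaxTree where
  edges : Set E
  bar_mem : ∀ e ∈ edges, X.bar e ∈ edges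
  existsUnique_path : ∀ v w, ∃! p, X.IsWalk v p w ∧ X.IsReduced p ∧ ∀ e ∈ p, e ∈ edges

/-- An orientation: a fundamental domain for the involution on the set of oriented edges. -/
structure Orientation where
  edges : Set E
  mem_iff : ∀ e, e ∈ edges ↔ X.bar e ∉ edges

lemma isWalk_append {u v w : V} {p q : List E} (hp : X.IsWalk u p v) (hq : X.IsWalk v q w) :
    X.IsWalk u (p ++ q) w := by
  induction p generalizing u with
  | nil => cases hp; exact hq
  | cons e p ih => exact ⟨hp.1, ih hp.2⟩

lemma isWalk_concat {u w : V} {p : List E} {e : E} (h : X.IsWalk u (p ++ [e]) w) :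
    X.IsWalk u p (X.minus e) ∧ X.plus e = w := by
  induction p generalizing u with
  | nil => exact ⟨h.1.symm, h.2⟩
  | cons f p ih => exact ⟨⟨h.1, (ih h.2).1⟩, (ih h.2).2⟩

/-! ### The automorphism group and its topology -/

/-- Pairs of permutations of the vertices and of the oriented edges which commute with the
extremity map and with the involution (hence with the origin map). -/
def autSubgroup : Subgroup (Equiv.Perm V × Equiv.Perm E) where
  carrier := {g | ∀ e, X.plus (g.2 e) = g.1 (X.plus e) ∧ X.bar (g.2 e) = g.2 (X.bar e)}
  one_mem' := fun _ => ⟨rfl, rfl⟩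
  mul_mem' := by
    intro a b ha hb e
    refine ⟨?_, ?_⟩
    · simp [(ha _).1, (hb _).1]
    · simp [(ha _).2, (hb _).2]
  inv_mem' := by
    intro a ha e
    have h := ha (a.2.symm e)
    rw [Equiv.apply_symm_apply] at h
    refine ⟨?_, ?_⟩
    · exact ((Equiv.symm_apply_eq _).2 h.1).symm
    · exact ((Equiv.symm_apply_eq _).2 h.2).symm

/-- The automorphism group of a graph. -/
def Aut : Type _ := X.autSubgroup

instance : Group X.Aut := inferInstanceAs (Group X.autSubgroup)

variable {X}

/-- The permutation of the vertices given by an automorphism. -/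
def Aut.onV (g : X.Aut) : Equiv.Perm V := g.1.1

/-- The permutation of the oriented edges given by an automorphism. -/
def Aut.onE (g : X.Aut) : Equiv.Perm E := g.1.2

@[simp] lemma Aut.onV_mul (g h : X.Aut) (v : V) : (g * h).onV v = g.onV (h.onV v) := rfl
@[simp] lemma Aut.onE_mul (g h : X.Aut) (e : E) : (g * h).onE e = g.onE (h.onE e) := rfl
@[simp] lemma Aut.onV_one (v : V) : (1 : X.Aut).onV v = v := rfl
@[simp] lemma Aut.onE_one (e : E) : (1 : X.Aut).onE e = e := rfl

variable (X)

/-- The topology of pointwise convergence (on the discrete sets of vertices and edges): the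
coarsest topology for which all maps `g ↦ g v` and `g ↦ g e` into discrete sets are continuous. -/
instance : TopologicalSpace X.Aut :=
  (⨅ v : V, TopologicalSpace.induced (fun g : X.Aut => g.onV v) ⊥) ⊓
    (⨅ e : E, TopologicalSpace.induced (fun g : X.Aut => g.onE e) ⊥)

lemma isOpen_onV (v w : V) : IsOpen {g : X.Aut | g.onV v = w} := by
  have h : (inferInstance : TopologicalSpace X.Aut) ≤
      TopologicalSpace.induced (fun g : X.Aut => g.onV v) ⊥ := inf_le_left.trans (iInf_le _ v)
  apply h
  exact ⟨{w}, trivial, rfl⟩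

lemma isOpen_onE (e f : E) : IsOpen {g : X.Aut | g.onE e = f} := by
  have h : (inferInstance : TopologicalSpace X.Aut) ≤
      TopologicalSpace.induced (fun g : X.Aut => g.onE e) ⊥ := inf_le_right.trans (iInf_le _ e)
  apply h
  exact ⟨{f}, trivial, rfl⟩

lemma continuous_to_aut {S : Type*} [TopologicalSpace S] {f : S → X.Aut}
    (hV : ∀ v w, IsOpen {s | (f s).onV v = w}) (hE : ∀ e e', IsOpen {s | (f s).onE e = e'}) :
    Continuous f := by
  refine continuous_inf_rng.2 ⟨continuous_iInf_rng.2 fun v => continuous_induced_rng.2 ?_,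
    continuous_iInf_rng.2 fun e => continuous_induced_rng.2 ?_⟩
  · let _ : TopologicalSpace V := ⊥
    have _ : DiscreteTopology V := ⟨rfl⟩
    exact continuous_discrete_rng.2 fun w => hV v w
  · let _ : TopologicalSpace E := ⊥
    have _ : DiscreteTopology E := ⟨rfl⟩
    exact continuous_discrete_rng.2 fun w => hE e w

instance : IsTopologicalGroup X.Aut where
  continuous_mul := by
    apply continuous_to_aut
    · intro v w
      have : {s : X.Aut × X.Aut | (s.1 * s.2).onV v = w} =
          ⋃ u, {s | s.2.onV v = u} ∩ {s | s.1.onV u = w} := by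
        ext s; simp
      rw [this]
      exact isOpen_iUnion fun u => ((X.isOpen_onV v u).preimage continuous_snd).inter
        ((X.isOpen_onV u w).preimage continuous_fst)
    · intro v w
      have : {s : X.Aut × X.Aut | (s.1 * s.2).onE v = w} =
          ⋃ u, {s | s.2.onE v = u} ∩ {s | s.1.onE u = w} := by
        ext s; simp
      rw [this]
      exact isOpen_iUnion fun u => ((X.isOpen_onE v u).preimage continuous_snd).inter
        ((X.isOpen_onE u w).preimage continuous_fst)
  continuous_inv := by
    apply continuous_to_aut
    · intro v w
      have : {s : X.Aut | (s⁻¹).onV v = w} = {s | s.onV w = v} := by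
        ext s
        constructor
        · rintro rfl
          change (s * s⁻¹).onV v = v
          simp
        · rintro rfl
          change (s⁻¹ * s).onV w = w
          simp
      rw [this]
      exact X.isOpen_onV w v
    · intro v w
      have : {s : X.Aut | (s⁻¹).onE v = w} = {s | s.onE w = v} := by
        ext s
        constructor
        · rintro rfl
          change (s * s⁻¹).onE v = v
          simp
        · rintro rfl
          change (s⁻¹ * s).onE w = w
          simp
      rw [this]
      exact X.isOpen_onE w v

end OGraph

/-! ### Graphs of `ℤⁿ`'s and their Bass-Serre fundamental groups -/

/-- The group `ℤⁿ`, written multiplicatively. -/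
abbrev ZZ (n : ℕ) : Type := Multiplicative (Fin n → ℤ)

/-- The group `ℝⁿ`, written multiplicatively, with its usual topology. -/
abbrev RR (n : ℕ) : Type := Multiplicative (Fin n → ℝ)

/-- A graph of groups on a connected graph, with all vertex and edge groups equal to `ℤⁿ`; the
monomorphism from the group of the edge `e` to the group of the vertex `plus e` is given by an
integer matrix `σ e` with non-zero determinant. -/
structure ZnGraph (n : ℕ) (V : Type*) (E : Type*) extends OGraph V E where
  connected : toOGraph.IsConnected
  σ : E → Matrix (Fin n) (Fin n) ℤ
  det_ne_zero : ∀ e, (σ e).det ≠ 0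

namespace ZnGraph

open Matrix

variable {n : ℕ} {V E : Type*} (𝒢 : ZnGraph n V E)

/-- The monomorphism from the group of the edge `e` to the group of the vertex `plus e`. -/
def edgeHom (e : E) : ZZ n →* ZZ n :=
  AddMonoidHom.toMultiplicative (Matrix.mulVecLin (𝒢.σ e)).toAddMonoidHom

/-- The free product of the vertex groups and of the free group on the oriented edges. -/
abbrev Pre (n : ℕ) (V : Type*) (E : Type*) : Type _ :=
  Monoid.Coprod (Monoid.CoprodI (fun _ : V => ZZ n)) (FreeGroup E)

/-- The vertex groups inside the free product. -/
def preVert (v : V) : ZZ n →* Pre n V E :=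
  Monoid.Coprod.inl.comp (Monoid.CoprodI.of (M := fun _ : V => ZZ n) (i := v))

/-- The generators `t_e` inside the free product. -/
def preStable (e : E) : Pre n V E := Monoid.Coprod.inr (FreeGroup.of e)

variable (T : 𝒢.toOGraph.MaxTree)

/-- The defining relations `t_e σ_e(g) t_e⁻¹ = σ_{bar e}(g)` and `t_e t_{bar e} = 1` for all
edges, and `t_e = 1` for the edges of the maximal tree. -/
def rels : Set (Pre n V E) :=
  {r | ∃ (e : E) (g : ZZ n), r = preStable e * preVert (𝒢.plus e) (𝒢.edgeHom e g) *
      (preStable e)⁻¹ * (preVert (𝒢.minus e) (𝒢.edgeHom (𝒢.bar e) g))⁻¹} ∪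
  {r | ∃ e : E, r = preStable e * preStable (𝒢.bar e)} ∪
  {r | ∃ e ∈ T.edges, r = preStable e}

/-- The Bass-Serre fundamental group of the graph of groups, relative to the maximal tree `T`. -/
def FundGroup : Type _ := Pre n V E ⧸ Subgroup.normalClosure (𝒢.rels T)

instance : Group (𝒢.FundGroup T) :=
  inferInstanceAs (Group (Pre n V E ⧸ Subgroup.normalClosure (𝒢.rels T)))

/-- The fundamental group (and, by restriction, each of its subgroups) is a discrete group. -/
instance : TopologicalSpace (𝒢.FundGroup T) := ⊥

instance : DiscreteTopology (𝒢.FundGroup T) := ⟨rfl⟩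

/-- The quotient map. -/
def proj : Pre n V E →* 𝒢.FundGroup T := QuotientGroup.mk' (Subgroup.normalClosure (𝒢.rels T))

/-- The homomorphism from the vertex group at `v` to the fundamental group. -/
def vert (v : V) : ZZ n →* 𝒢.FundGroup T := (𝒢.proj T).comp (preVert v)

/-- The stable letter `t_e` in the fundamental group. -/
def stable (e : E) : 𝒢.FundGroup T := 𝒢.proj T (preStable e)

lemma proj_eq_one {r : Pre n V E} (h : r ∈ 𝒢.rels T) : 𝒢.proj T r = 1 :=
  (QuotientGroup.eq_one_iff r).2 (Subgroup.subset_normalClosure h)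

lemma stable_conj (e : E) (g : ZZ n) :
    𝒢.stable T e * 𝒢.vert T (𝒢.plus e) (𝒢.edgeHom e g) * (𝒢.stable T e)⁻¹ =
      𝒢.vert T (𝒢.minus e) (𝒢.edgeHom (𝒢.bar e) g) := by
  have h := 𝒢.proj_eq_one T (Or.inl (Or.inl ⟨e, g, rfl⟩))
  simp only [map_mul] at h
  exact mul_inv_eq_one.1 h

lemma stable_mul_bar (e : E) : 𝒢.stable T e * 𝒢.stable T (𝒢.bar e) = 1 := by
  have h := 𝒢.proj_eq_one T (Or.inl (Or.inr ⟨e, rfl⟩))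
  rwa [map_mul] at h

lemma stable_bar (e : E) : 𝒢.stable T (𝒢.bar e) = (𝒢.stable T e)⁻¹ :=
  (inv_eq_of_mul_eq_one_right (𝒢.stable_mul_bar T e)).symm

lemma stable_tree {e : E} (he : e ∈ T.edges) : 𝒢.stable T e = 1 :=
  𝒢.proj_eq_one T (Or.inr ⟨e, he, rfl⟩)

section lift

variable {K : Type*} [Group K] (f : V → ZZ n →* K) (s : E → K)

/-- A homomorphism out of the fundamental group, given by its values on the generators. -/
def lift
    (h1 : ∀ e g, s e * f (𝒢.plus e) (𝒢.edgeHom e g) * (s e)⁻¹ =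
      f (𝒢.minus e) (𝒢.edgeHom (𝒢.bar e) g))
    (h2 : ∀ e, s e * s (𝒢.bar e) = 1) (h3 : ∀ e ∈ T.edges, s e = 1) :
    𝒢.FundGroup T →* K :=
  QuotientGroup.lift (Subgroup.normalClosure (𝒢.rels T))
    (Monoid.Coprod.lift (Monoid.CoprodI.lift f) (FreeGroup.lift s)) (by
      refine Subgroup.normalClosure_le_normal ?_
      rintro r ((⟨e, g, rfl⟩ | ⟨e, rfl⟩) | ⟨e, he, rfl⟩)
      · change Monoid.Coprod.lift (Monoid.CoprodI.lift f) (FreeGroup.lift s) _ = 1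
        have hinv : ∀ x : Pre n V E, Monoid.Coprod.lift (Monoid.CoprodI.lift f)
            (FreeGroup.lift s) x⁻¹ = (Monoid.Coprod.lift (Monoid.CoprodI.lift f)
            (FreeGroup.lift s) x)⁻¹ := fun x => MonoidHom.map_inv _ x
        rw [map_mul, hinv, mul_inv_eq_one, map_mul, map_mul, hinv]
        simpa [preVert, preStable] using h1 e g
      · simpa [preVert, preStable, MonoidHom.mem_ker] using h2 e
      · simpa [preVert, preStable, MonoidHom.mem_ker] using h3 e he)

variable {f s}
variable (h1 : ∀ e g, s e * f (𝒢.plus e) (𝒢.edgeHom e g) * (s e)⁻¹ =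
      f (𝒢.minus e) (𝒢.edgeHom (𝒢.bar e) g))
    (h2 : ∀ e, s e * s (𝒢.bar e) = 1) (h3 : ∀ e ∈ T.edges, s e = 1)

@[simp] lemma lift_vert (v : V) (g : ZZ n) : 𝒢.lift T f s h1 h2 h3 (𝒢.vert T v g) = f v g := by
  change Monoid.Coprod.lift (Monoid.CoprodI.lift f) (FreeGroup.lift s) (preVert v g) = f v g
  simp [preVert]

@[simp] lemma lift_stable (e : E) : 𝒢.lift T f s h1 h2 h3 (𝒢.stable T e) = s e := by
  change Monoid.Coprod.lift (Monoid.CoprodI.lift f) (FreeGroup.lift s) (preStable e) = s e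
  simp [preStable]

end lift

lemma hom_ext {K : Type*} [Group K] {a b : 𝒢.FundGroup T →* K}
    (hv : ∀ v g, a (𝒢.vert T v g) = b (𝒢.vert T v g))
    (hs : ∀ e, a (𝒢.stable T e) = b (𝒢.stable T e)) : a = b := by
  refine QuotientGroup.monoidHom_ext _ (Monoid.Coprod.hom_ext ?_ ?_)
  · refine Monoid.CoprodI.ext_hom _ _ fun v => MonoidHom.ext fun g => hv v g
  · exact FreeGroup.ext_hom _ _ fun e => hs e

/-! ### The universal cover and the action on it -/

/-- The vertex group `G_v` as a subgroup of the fundamental group. -/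
def vertSub (v : V) : Subgroup (𝒢.FundGroup T) := (𝒢.vert T v).range

/-- The edge group `G_e` as a subgroup of the fundamental group: the image of the edge group in
the vertex group at `plus e`. -/
def edgeSub (e : E) : Subgroup (𝒢.FundGroup T) :=
  ((𝒢.vert T (𝒢.plus e)).comp (𝒢.edgeHom e)).range

/-- The vertices of the universal cover. -/
def CoverV : Type _ := Σ v : V, 𝒢.FundGroup T ⧸ 𝒢.vertSub T v

/-- The oriented edges of the universal cover. -/
def CoverE : Type _ := Σ e : E, 𝒢.FundGroup T ⧸ 𝒢.edgeSub T e

/-- The vertex `g G_v`. -/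
def mkV (v : V) (g : 𝒢.FundGroup T) : 𝒢.CoverV T := ⟨v, (g : 𝒢.FundGroup T ⧸ 𝒢.vertSub T v)⟩

/-- The edge `g G_e`. -/
def mkE (e : E) (g : 𝒢.FundGroup T) : 𝒢.CoverE T := ⟨e, (g : 𝒢.FundGroup T ⧸ 𝒢.edgeSub T e)⟩

lemma mkE_surj (x : 𝒢.CoverE T) : ∃ e g, x = 𝒢.mkE T e g := by
  obtain ⟨e, q⟩ := x
  obtain ⟨g, rfl⟩ := QuotientGroup.mk_surjective q
  exact ⟨e, g, rfl⟩

lemma mkV_surj (x : 𝒢.CoverV T) : ∃ v g, x = 𝒢.mkV T v g := by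
  obtain ⟨e, q⟩ := x
  obtain ⟨g, rfl⟩ := QuotientGroup.mk_surjective q
  exact ⟨e, g, rfl⟩

lemma edgeSub_le (e : E) : 𝒢.edgeSub T e ≤ 𝒢.vertSub T (𝒢.plus e) := by
  rintro _ ⟨g, rfl⟩
  exact ⟨_, rfl⟩

lemma stable_conj_mem {e : E} {h : 𝒢.FundGroup T} (hh : h ∈ 𝒢.edgeSub T e) :
    𝒢.stable T e * h * (𝒢.stable T e)⁻¹ ∈ 𝒢.edgeSub T (𝒢.bar e) := by
  obtain ⟨g, rfl⟩ := hh
  exact ⟨g, (𝒢.stable_conj T e g).symm⟩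

/-- The extremity map of the universal cover: `g G_e ↦ g G_{plus e}`. -/
def coverPlus (x : 𝒢.CoverE T) : 𝒢.CoverV T :=
  ⟨𝒢.plus x.1, Quotient.map' (s₁ := QuotientGroup.leftRel (𝒢.edgeSub T x.1))
    (s₂ := QuotientGroup.leftRel (𝒢.vertSub T (𝒢.plus x.1))) id (by
      intro a b hab
      rw [QuotientGroup.leftRel_apply] at hab ⊢
      exact 𝒢.edgeSub_le T _ hab) x.2⟩

/-- The involution of the universal cover: `g G_e ↦ g t_e⁻¹ G_{bar e}`, so that the origin of
`g G_e` is `g t_e⁻¹ G_{minus e}` (where `t_e = 1` if `e` lies in the maximal tree). -/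
def coverBar (x : 𝒢.CoverE T) : 𝒢.CoverE T :=
  ⟨𝒢.bar x.1, Quotient.map' (s₁ := QuotientGroup.leftRel (𝒢.edgeSub T x.1))
    (s₂ := QuotientGroup.leftRel (𝒢.edgeSub T (𝒢.bar x.1)))
    (fun g => g * (𝒢.stable T x.1)⁻¹) (by
      intro a b hab
      rw [QuotientGroup.leftRel_apply] at hab ⊢
      have h := 𝒢.stable_conj_mem T hab
      simpa [mul_assoc] using h) x.2⟩

lemma coverPlus_mk (e : E) (g : 𝒢.FundGroup T) :
    𝒢.coverPlus T (𝒢.mkE T e g) = 𝒢.mkV T (𝒢.plus e) g := rfl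

lemma coverBar_mk (e : E) (g : 𝒢.FundGroup T) :
    𝒢.coverBar T (𝒢.mkE T e g) = 𝒢.mkE T (𝒢.bar e) (g * (𝒢.stable T e)⁻¹) := rfl

/-- The universal cover (Bass-Serre tree) of the graph of groups. -/
def cover : OGraph (𝒢.CoverV T) (𝒢.CoverE T) where
  bar := 𝒢.coverBar T
  plus := 𝒢.coverPlus T
  bar_bar := by
    intro x
    obtain ⟨e, g, rfl⟩ := 𝒢.mkE_surj T x
    rw [coverBar_mk, coverBar_mk, stable_bar, 𝒢.bar_bar]
    simp
  bar_ne := by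
    intro x h
    exact 𝒢.bar_ne x.1 (congrArg Sigma.fst h)

/-- Left translation on the vertices of the universal cover. -/
def transV : 𝒢.FundGroup T →* Equiv.Perm (𝒢.CoverV T) where
  toFun g :=
    { toFun := fun x => ⟨x.1, g • x.2⟩
      invFun := fun x => ⟨x.1, g⁻¹ • x.2⟩
      left_inv := fun x => Sigma.ext rfl (heq_of_eq (inv_smul_smul _ _))
      right_inv := fun x => Sigma.ext rfl (heq_of_eq (smul_inv_smul _ _)) }
  map_one' := by ext x : 1; exact Sigma.ext rfl (heq_of_eq (one_smul _ _))
  map_mul' g h := by ext x : 1; exact Sigma.ext rfl (heq_of_eq (mul_smul _ _ _))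

/-- Left translation on the edges of the universal cover. -/
def transE : 𝒢.FundGroup T →* Equiv.Perm (𝒢.CoverE T) where
  toFun g :=
    { toFun := fun x => ⟨x.1, g • x.2⟩
      invFun := fun x => ⟨x.1, g⁻¹ • x.2⟩
      left_inv := fun x => Sigma.ext rfl (heq_of_eq (inv_smul_smul _ _))
      right_inv := fun x => Sigma.ext rfl (heq_of_eq (smul_inv_smul _ _)) }
  map_one' := by ext x : 1; exact Sigma.ext rfl (heq_of_eq (one_smul _ _))
  map_mul' g h := by ext x : 1; exact Sigma.ext rfl (heq_of_eq (mul_smul _ _ _))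

lemma transV_mk (g h : 𝒢.FundGroup T) (v : V) :
    𝒢.transV T g (𝒢.mkV T v h) = 𝒢.mkV T v (g * h) := rfl

lemma transE_mk (g h : 𝒢.FundGroup T) (e : E) :
    𝒢.transE T g (𝒢.mkE T e h) = 𝒢.mkE T e (g * h) := rfl

/-- The homomorphism from the fundamental group to the automorphism group of the universal
cover, given by left translation. -/
def ι : 𝒢.FundGroup T →* (𝒢.cover T).Aut :=
  ((𝒢.transV T).prod (𝒢.transE T)).codRestrict (𝒢.cover T).autSubgroup (by
    intro g x
    obtain ⟨e, h, rfl⟩ := 𝒢.mkE_surj T x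
    change 𝒢.coverPlus T (𝒢.transE T g _) = 𝒢.transV T g (𝒢.coverPlus T _) ∧
      𝒢.coverBar T (𝒢.transE T g _) = 𝒢.transE T g (𝒢.coverBar T _)
    simp only [transE_mk, coverPlus_mk, transV_mk, coverBar_mk, mul_assoc, and_self])

lemma ι_onV (g h : 𝒢.FundGroup T) (v : V) :
    (𝒢.ι T g).onV (𝒢.mkV T v h) = 𝒢.mkV T v (g * h) := rfl

/-- The closure of the image of the fundamental group in the automorphism group of the tree. -/
def closureι : Subgroup (𝒢.cover T).Aut := (𝒢.ι T).range.topologicalClosure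

/-! ### The group generated by the stable letters -/

variable (A : 𝒢.toOGraph.Orientation)

/-- The subgroup `H_d` generated by the stable letters `t_e`, where `e` runs over the edges of
the orientation which do not lie in the maximal tree. -/
def H : Subgroup (𝒢.FundGroup T) :=
  Subgroup.closure {x | ∃ e ∈ A.edges, e ∉ T.edges ∧ x = 𝒢.stable T e}

lemma stable_mem_H (e : E) : 𝒢.stable T e ∈ 𝒢.H T A := by
  by_cases hT : e ∈ T.edges
  · rw [𝒢.stable_tree T hT]; exact one_mem _
  · by_cases hA : e ∈ A.edges
    · exact Subgroup.subset_closure ⟨e, hA, hT, rfl⟩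
    · have hb : 𝒢.bar e ∈ A.edges := by
        by_contra hb
        exact hA ((A.mem_iff e).2 hb)
      have hbT : 𝒢.bar e ∉ T.edges := fun h => hT (by
        have := T.bar_mem _ h
        rwa [𝒢.bar_bar] at this)
      have : (𝒢.stable T e)⁻¹ ∈ 𝒢.H T A := by
        rw [← stable_bar]
        exact Subgroup.subset_closure ⟨_, hb, hbT, rfl⟩
      exact (Subgroup.inv_mem_iff _).1 this

/-- The epimorphism onto `H_d` which kills the vertex groups and fixes the stable letters. -/
def φ : 𝒢.FundGroup T →* 𝒢.H T A :=
  𝒢.lift T (fun _ => 1) (fun e => ⟨𝒢.stable T e, 𝒢.stable_mem_H T A e⟩)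
    (by intro e g; simp) (fun e => Subtype.ext (𝒢.stable_mul_bar T e))
    (fun _ he => Subtype.ext (𝒢.stable_tree T he))

@[simp] lemma φ_vert (v : V) (g : ZZ n) : 𝒢.φ T A (𝒢.vert T v g) = 1 := by simp [φ]

@[simp] lemma φ_stable (e : E) :
    𝒢.φ T A (𝒢.stable T e) = ⟨𝒢.stable T e, 𝒢.stable_mem_H T A e⟩ := by simp [φ]

/-- The map `g G_v ↦ φ g` on the vertices of the universal cover. -/
def label (x : 𝒢.CoverV T) : 𝒢.H T A :=
  Quotient.liftOn' (s₁ := QuotientGroup.leftRel (𝒢.vertSub T x.1)) x.2 (𝒢.φ T A) (by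
    intro a b hab
    rw [QuotientGroup.leftRel_apply] at hab
    obtain ⟨g, hg⟩ := hab
    have : 𝒢.φ T A (a⁻¹ * b) = 1 := by rw [← hg]; simp
    rw [map_mul, map_inv, inv_mul_eq_one] at this
    exact this)

lemma label_mk (v : V) (g : 𝒢.FundGroup T) : 𝒢.label T A (𝒢.mkV T v g) = 𝒢.φ T A g := rfl

lemma isClosed_label (x y : 𝒢.CoverV T) : IsClosed {g : (𝒢.cover T).Aut |
    𝒢.label T A (g.onV x) * (𝒢.label T A x)⁻¹ = 𝒢.label T A (g.onV y) * (𝒢.label T A y)⁻¹} := by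
  have hc : ∀ x : 𝒢.CoverV T,
      Continuous (fun g : (𝒢.cover T).Aut => 𝒢.label T A (g.onV x)) := by
    intro x
    refine continuous_discrete_rng.2 fun b => ?_
    have : (fun g : (𝒢.cover T).Aut => 𝒢.label T A (g.onV x)) ⁻¹' {b} =
        ⋃ w ∈ {w | 𝒢.label T A w = b}, {g | g.onV x = w} := by
      ext g; simp
    rw [this]
    exact isOpen_biUnion fun w _ => (𝒢.cover T).isOpen_onV x w
  exact isClosed_eq ((hc x).mul continuous_const) ((hc y).mul continuous_const)

lemma label_eq {g : (𝒢.cover T).Aut} (hg : g ∈ 𝒢.closureι T) (x y : 𝒢.CoverV T) :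
    𝒢.label T A (g.onV x) * (𝒢.label T A x)⁻¹ = 𝒢.label T A (g.onV y) * (𝒢.label T A y)⁻¹ := by
  refine closure_minimal ?_ (𝒢.isClosed_label T A x y) hg
  rintro _ ⟨h, rfl⟩
  obtain ⟨v, a, rfl⟩ := 𝒢.mkV_surj T x
  obtain ⟨w, b, rfl⟩ := 𝒢.mkV_surj T y
  simp only [Set.mem_ofPred_eq, ι_onV, label_mk, map_mul, mul_inv_cancel_right]

variable (v₀ : V)

/-- The continuous extension of `φ` to the closure of the image of the fundamental group (see
`φbar_ι` and `continuous_φbar`; it is unique, hence does not depend on `v₀`). -/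
def φbar : 𝒢.closureι T →* 𝒢.H T A where
  toFun g := 𝒢.label T A (g.1.onV (𝒢.mkV T v₀ 1)) * (𝒢.label T A (𝒢.mkV T v₀ 1))⁻¹
  map_one' := by simp
  map_mul' g h := by
    rw [𝒢.label_eq T A g.2 (𝒢.mkV T v₀ 1) (h.1.onV (𝒢.mkV T v₀ 1))]
    simp

lemma φbar_ι (g : 𝒢.FundGroup T) (hg : 𝒢.ι T g ∈ 𝒢.closureι T) :
    𝒢.φbar T A v₀ ⟨𝒢.ι T g, hg⟩ = 𝒢.φ T A g := by
  change 𝒢.label T A ((𝒢.ι T g).onV (𝒢.mkV T v₀ 1)) * (𝒢.label T A (𝒢.mkV T v₀ 1))⁻¹ = _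
  simp [ι_onV, label_mk]

lemma continuous_φbar : Continuous (𝒢.φbar T A v₀) := by
  refine continuous_discrete_rng.2 fun b => ?_
  have : (𝒢.φbar T A v₀) ⁻¹' {b} = Subtype.val ⁻¹' (⋃ w ∈ {w | 𝒢.label T A w *
      (𝒢.label T A (𝒢.mkV T v₀ 1))⁻¹ = b}, {g | g.onV (𝒢.mkV T v₀ 1) = w}) := by
    ext g; simp [φbar]
  rw [this]
  exact (isOpen_biUnion fun w _ => (𝒢.cover T).isOpen_onV _ w).preimage continuous_subtype_val

/-! ### The homomorphisms to `ℝⁿ ⋊ GL_n(ℝ)` and `ℝⁿ ⋊ H_d` -/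

/-- The linear action of `GL_n(ℝ)` on `ℝⁿ`. -/
def glAct (n : ℕ) : GL (Fin n) ℝ →* MulAut (RR n) where
  toFun M := AddEquiv.toMultiplicative
    { toFun := fun x => (M : Matrix (Fin n) (Fin n) ℝ) *ᵥ x
      invFun := fun x => ((M⁻¹ : GL (Fin n) ℝ) : Matrix (Fin n) (Fin n) ℝ) *ᵥ x
      left_inv := fun x => by simp [Matrix.mulVec_mulVec]
      right_inv := fun x => by simp [Matrix.mulVec_mulVec]
      map_add' := fun x y => Matrix.mulVec_add _ _ _ }
  map_one' := by
    ext x : 1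
    change Multiplicative.ofAdd ((1 : Matrix (Fin n) (Fin n) ℝ) *ᵥ x.toAdd) = x
    simp
  map_mul' M N := by
    ext x : 1
    change Multiplicative.ofAdd (((M : Matrix (Fin n) (Fin n) ℝ) * (N : Matrix (Fin n) (Fin n) ℝ)) *ᵥ x.toAdd) =
      Multiplicative.ofAdd ((M : Matrix (Fin n) (Fin n) ℝ) *ᵥ
        ((N : Matrix (Fin n) (Fin n) ℝ) *ᵥ x.toAdd))
    simp [Matrix.mulVec_mulVec]

lemma glAct_apply (M : GL (Fin n) ℝ) (x : RR n) :
    glAct n M x = Multiplicative.ofAdd ((M : Matrix (Fin n) (Fin n) ℝ) *ᵥ x.toAdd) := rfl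

/-- The product topology on a semidirect product. -/
instance instTopSemidirect {N K : Type*} [Group N] [Group K] [TopologicalSpace N]
    [TopologicalSpace K] (θ : K →* MulAut N) : TopologicalSpace (N ⋊[θ] K) :=
  TopologicalSpace.induced (fun x => (x.left, x.right)) inferInstance

/-- The matrix `σ_e` as a real invertible matrix. -/
def sig (e : E) : GL (Fin n) ℝ :=
  Matrix.GeneralLinearGroup.mkOfDetNeZero ((𝒢.σ e).map (Int.cast : ℤ → ℝ)) (by
    have h : ((𝒢.σ e).map (Int.cast : ℤ → ℝ)).det = ((𝒢.σ e).det : ℝ) :=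
      ((Int.castRingHom ℝ).map_det (𝒢.σ e)).symm
    rw [h]
    exact_mod_cast 𝒢.det_ne_zero e)

/-- The path without backtracking from `v` to `w` in the maximal tree. -/
def treePath (v w : V) : List E := (T.existsUnique_path v w).choose

lemma treePath_spec (v w : V) : 𝒢.IsWalk v (𝒢.treePath T v w) w ∧
    𝒢.IsReduced (𝒢.treePath T v w) ∧ ∀ e ∈ 𝒢.treePath T v w, e ∈ T.edges :=
  (T.existsUnique_path v w).choose_spec.1

lemma eq_treePath {v w : V} {p : List E} (h1 : 𝒢.IsWalk v p w) (h2 : 𝒢.IsReduced p)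
    (h3 : ∀ e ∈ p, e ∈ T.edges) : p = 𝒢.treePath T v w :=
  (T.existsUnique_path v w).choose_spec.2 p ⟨h1, h2, h3⟩

/-- The ordered product, along a path, of the matrices `σ_{bar e} σ_e⁻¹`. An edge of a fixed
orientation which is travelled backwards thus contributes the inverse of `σ_{bar e} σ_e⁻¹`. -/
def pathMat (p : List E) : GL (Fin n) ℝ :=
  (p.map fun e => 𝒢.sig (𝒢.bar e) * (𝒢.sig e)⁻¹).prod

/-- The matrix `τ_v`: the ordered product along the path from `v₀` to `v` in the tree. -/
def τ (v : V) : GL (Fin n) ℝ := 𝒢.pathMat (𝒢.treePath T v₀ v)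

lemma τ_tree {e : E} (he : e ∈ T.edges) :
    𝒢.τ T v₀ (𝒢.minus e) * 𝒢.sig (𝒢.bar e) = 𝒢.τ T v₀ (𝒢.plus e) * 𝒢.sig e := by
  obtain ⟨h1, h2, h3⟩ := 𝒢.treePath_spec T v₀ (𝒢.minus e)
  by_cases hlast : ∃ q, 𝒢.treePath T v₀ (𝒢.minus e) = q ++ [𝒢.bar e]
  · obtain ⟨q, hq⟩ := hlast
    have hq' : q = 𝒢.treePath T v₀ (𝒢.plus e) := by
      rw [hq] at h1 h2 h3
      refine 𝒢.eq_treePath T ?_ (List.IsChain.left_of_append h2)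
        (fun f hf => h3 f (List.mem_append_left _ hf))
      have := (𝒢.isWalk_concat h1).1
      simpa [OGraph.minus, 𝒢.bar_bar] using this
    simp only [τ]
    rw [hq, ← hq']
    simp [pathMat, 𝒢.bar_bar, mul_assoc]
  · have hq : 𝒢.treePath T v₀ (𝒢.minus e) ++ [e] = 𝒢.treePath T v₀ (𝒢.plus e) := by
      refine 𝒢.eq_treePath T (𝒢.isWalk_append h1 ⟨rfl, rfl⟩) ?_ ?_
      · refine List.isChain_append.2 ⟨h2, List.isChain_singleton _, ?_⟩
        intro x hx y hy hxy
        simp only [List.head?_cons, Option.mem_def, Option.some.injEq] at hy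
        subst hy
        apply hlast
        obtain ⟨q, hq⟩ := List.mem_getLast?_eq_getLast hx
        refine ⟨(𝒢.treePath T v₀ (𝒢.minus e)).dropLast, ?_⟩
        have hbx : 𝒢.bar e = x := by rw [hxy, 𝒢.bar_bar]
        rw [hbx, hq, List.dropLast_append_getLast]
      · intro f hf
        rcases List.mem_append.1 hf with hf | hf
        · exact h3 f hf
        · rw [List.mem_singleton.1 hf]; exact he
    simp only [τ]
    rw [← hq]
    simp [pathMat, mul_assoc]

/-- The restriction of `μ` to the vertex group at `v`, with values in `ℝⁿ`: the map `τ_v`. -/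
def vertVec (v : V) : ZZ n →* RR n where
  toFun g := Multiplicative.ofAdd ((𝒢.τ T v₀ v : Matrix (Fin n) (Fin n) ℝ) *ᵥ
    fun i => ((g.toAdd i : ℤ) : ℝ))
  map_one' := by
    rw [← ofAdd_zero]
    congr 1
    ext i
    simp [Matrix.mulVec, dotProduct]
  map_mul' g h := by
    rw [← ofAdd_add, ← Matrix.mulVec_add]
    congr 2
    ext i
    simp

/-- The matrix `τ_{e₋} σ_{bar e} σ_e⁻¹ τ_{e₊}⁻¹`; it is trivial for the edges of the tree. -/
def stableMat (e : E) : GL (Fin n) ℝ :=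
  𝒢.τ T v₀ (𝒢.minus e) * 𝒢.sig (𝒢.bar e) * (𝒢.sig e)⁻¹ * (𝒢.τ T v₀ (𝒢.plus e))⁻¹

lemma vertVec_edgeHom (v : V) (e : E) (g : ZZ n) :
    𝒢.vertVec T v₀ v (𝒢.edgeHom e g) =
      glAct n (𝒢.τ T v₀ v * 𝒢.sig e) (Multiplicative.ofAdd fun i => ((g.toAdd i : ℤ) : ℝ)) := by
  rw [map_mul]
  change Multiplicative.ofAdd ((𝒢.τ T v₀ v : Matrix (Fin n) (Fin n) ℝ) *ᵥ _) =
    Multiplicative.ofAdd ((𝒢.τ T v₀ v : Matrix (Fin n) (Fin n) ℝ) *ᵥ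
      ((𝒢.sig e : Matrix (Fin n) (Fin n) ℝ) *ᵥ _))
  congr 2
  ext i
  simp [edgeHom, sig, Matrix.mulVec, dotProduct, Matrix.GeneralLinearGroup.mkOfDetNeZero]

/-- The homomorphism `μ` from the fundamental group to the affine group: `τ_v` on the vertex
group at `v`, and `stableMat e` on the stable letter `t_e`. -/
def μ : 𝒢.FundGroup T →* RR n ⋊[glAct n] GL (Fin n) ℝ :=
  𝒢.lift T (fun v => SemidirectProduct.inl.comp (𝒢.vertVec T v₀ v))
    (fun e => SemidirectProduct.inr (𝒢.stableMat T v₀ e))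
    (by
      intro e g
      rw [← map_inv]
      simp only [MonoidHom.comp_apply]
      rw [← SemidirectProduct.inl_aut]
      congr 1
      rw [vertVec_edgeHom, vertVec_edgeHom, ← MulAut.mul_apply, ← map_mul]
      congr 2
      simp [stableMat, mul_assoc])
    (by
      intro e
      rw [← map_mul]
      simp [stableMat, OGraph.minus, 𝒢.bar_bar, mul_assoc])
    (by
      intro e he
      have : 𝒢.stableMat T v₀ e = 1 := by
        rw [stableMat, τ_tree 𝒢 T v₀ he]
        simp
      simp [this])

/-- The linear action of `H_d` on `ℝⁿ` through `μ`. -/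
def linH : 𝒢.H T A →* GL (Fin n) ℝ :=
  SemidirectProduct.rightHom.comp ((𝒢.μ T v₀).comp (𝒢.H T A).subtype)

/-- The semidirect product `ℝⁿ ⋊_μ H_d`, where `H_d` is discrete. -/
abbrev SemiH : Type _ := RR n ⋊[(glAct n).comp (𝒢.linH T A v₀)] 𝒢.H T A

lemma linH_φ (g : 𝒢.FundGroup T) : 𝒢.linH T A v₀ (𝒢.φ T A g) = (𝒢.μ T v₀ g).right := by
  have h : (𝒢.linH T A v₀).comp (𝒢.φ T A) = SemidirectProduct.rightHom.comp (𝒢.μ T v₀) := by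
    refine 𝒢.hom_ext T ?_ ?_
    · intro v g
      simp [μ]
    · intro e
      simp [linH]
  exact DFunLike.congr_fun h g

/-- The homomorphism `ν` to `ℝⁿ ⋊_μ H_d` through which `μ` factors. -/
def ν : 𝒢.FundGroup T →* 𝒢.SemiH T A v₀ where
  toFun g := ⟨(𝒢.μ T v₀ g).left, 𝒢.φ T A g⟩
  map_one' := by ext <;> simp
  map_mul' g h := by
    refine SemidirectProduct.ext ?_ ?_
    · simp [linH_φ]
    · simp

/-! ### The fiber product and cocompact lattices -/

/-- The fiber product `W` of `φbar : closureι → H_d` and of the projection `ℝⁿ ⋊_μ H_d → H_d`,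
as a subgroup of `Aut × (ℝⁿ ⋊_μ H_d)`. -/
def W : Subgroup ((𝒢.cover T).Aut × 𝒢.SemiH T A v₀) where
  carrier := {p | ∃ hp : p.1 ∈ 𝒢.closureι T, 𝒢.φbar T A v₀ ⟨p.1, hp⟩ = p.2.right}
  one_mem' := ⟨one_mem _, map_one (𝒢.φbar T A v₀)⟩
  mul_mem' := by
    rintro a b ⟨ha, ha'⟩ ⟨hb, hb'⟩
    refine ⟨mul_mem ha hb, ?_⟩
    rw [Prod.snd_mul, SemidirectProduct.mul_right, ← ha', ← hb', ← map_mul]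
    rfl
  inv_mem' := by
    rintro a ⟨ha, ha'⟩
    refine ⟨inv_mem ha, ?_⟩
    rw [Prod.snd_inv, SemidirectProduct.inv_right, ← ha', ← map_inv]
    rfl

end ZnGraph

/-- A subgroup `Γ` of a topological group `W` is a cocompact lattice if it is discrete and the
quotient `W ⧸ Γ` is compact. -/
def IsCocompactLattice {W : Type*} [Group W] [TopologicalSpace W] (Γ : Subgroup W) : Prop :=
  DiscreteTopology Γ ∧ CompactSpace (W ⧸ Γ)

end GraphZn

end

/-!
The vertex groups of `G` are pairwise commensurable, and each of them is commensurated by `G`. So a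
vertex group has finite orbits in the universal cover, and its closure in the automorphism group is
compact; this closure is the stabilizer of a vertex in the closure of `ι(G)`, hence open there.

An element of `G` which fixes the base vertex lies in the base vertex group `ℤⁿ`, on which `μ` and
`ν` are the standard inclusion in the translation group `ℝⁿ`; such an element is trivial as soon as
its translation part has norm less than `1`. Thus `1` is the only element of `G` which `ι × μ` or
`ι × ν` sends to some neighbourhood of `1`: this gives injectivity and discreteness, and properness
follows since discrete subgroups are closed. For cocompactness, an element of `W` is first moved by
`G` so as to fix the base vertex, and then by the base vertex group so that its translation part
lies in the unit cube.
-/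

open Filter

noncomputable section

namespace GraphZn

lemma injective_of_forall_mem_imp_eq_one {Γ G : Type*} [Group Γ] [Group G] {f : Γ →* G} {U : Set G}
    (hU : 1 ∈ U) (hf : ∀ γ, f γ ∈ U → γ = 1) : Function.Injective f :=
  (injective_iff_map_eq_one f).2 fun γ hγ => hf γ (hγ ▸ hU)

section TopologicalGroup

variable {G : Type*} [Group G] [TopologicalSpace G]

lemma exists_mul_mem_topologicalClosure_inf [IsTopologicalGroup G] {Γ U : Subgroup G}
    (hU : IsOpen (U : Set G)) {g : G} (hg : g ∈ Γ.topologicalClosure) :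
    ∃ γ ∈ Γ, g * γ ∈ (Γ ⊓ U).topologicalClosure := by
  have hgU : IsOpen {x | g * x ∈ U} := hU.preimage (continuous_const_mul g)
  obtain ⟨γ, hγU, hγ⟩ := mem_closure_iff.1 (inv_mem hg) _ hgU
    (show g * g⁻¹ ∈ U by rw [mul_inv_cancel]; exact one_mem U)
  refine ⟨γ, hγ, ?_⟩
  have hclosure : g * γ ∈ closure (Γ : Set G) :=
    mul_mem hg (Γ.le_topologicalClosure hγ)
  have := hU.inter_closure ⟨hγU, hclosure⟩
  rwa [Set.inter_comm] at this

lemma isDiscrete_range_of_forall_mem_imp_eq_one [IsTopologicalGroup G] {Γ : Type*} [Group Γ]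
    {f : Γ →* G} {U : Set G} (hU : U ∈ 𝓝 1) (hf : ∀ γ, f γ ∈ U → γ = 1) :
    IsDiscrete (f.range : Set G) := by
  refine isDiscrete_iff_discreteTopology.2 (?_ : DiscreteTopology f.range)
  have hone : {1} ∈ 𝓝 (1 : f.range) := by
    filter_upwards [continuous_subtype_val.continuousAt.preimage_mem_nhds hU]
    rintro ⟨_, γ, rfl⟩ hγ
    exact Subtype.ext ((congrArg f (hf γ hγ)).trans (map_one f))
  exact discreteTopology_of_isOpen_singleton_one
    (isOpen_iff_mem_nhds.2 fun x hx => by rwa [hx])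

lemma isCocompactLattice_subgroupOf {Γ W : Subgroup G} (hΓ : IsDiscrete (Γ : Set G)) {K : Set G}
    (hK : IsCompact K) (hKW : K ⊆ W) (hcover : ∀ g ∈ W, ∃ γ ∈ Γ, g * γ ∈ K) :
    IsCocompactLattice (Γ.subgroupOf W) := by
  constructor
  · have : DiscreteTopology Γ := isDiscrete_iff_discreteTopology.1 hΓ
    let incl : Γ.subgroupOf W → Γ := fun x => ⟨x.1.1, x.2⟩
    refine DiscreteTopology.of_continuous_injective (f := incl) (by fun_prop) fun x y hxy => ?_
    exact Subtype.ext (Subtype.ext (congrArg (Subtype.val : Γ → G) hxy))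
  · have hKcompact : IsCompact (Subtype.val ⁻¹' K : Set W) := by
      rwa [Subtype.isCompact_iff, Set.image_preimage_eq_of_subset (by simpa using hKW)]
    refine ⟨(hKcompact.image (f := ((↑) : W → W ⧸ Γ.subgroupOf W))
      continuous_quotient_mk').of_isClosed_subset isClosed_univ fun x _ => ?_⟩
    obtain ⟨g, rfl⟩ := QuotientGroup.mk_surjective x
    obtain ⟨γ, hγ, hgγ⟩ := hcover g g.2
    have hγW : γ ∈ W := (mul_mem_cancel_left g.2).1 (hKW hgγ)
    exact ⟨g * ⟨γ, hγW⟩, hgγ, QuotientGroup.mk_mul_of_mem g hγ⟩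

end TopologicalGroup

/-! ### Semidirect products -/

section SemidirectProduct

variable {N K : Type*} [Group N] [Group K] [TopologicalSpace N] [TopologicalSpace K]
  (θ : K →* MulAut N)

lemma continuous_semidirectProduct_left : Continuous (fun x : N ⋊[θ] K => x.left) :=
  continuous_fst.comp (continuous_induced_dom (f := fun x : N ⋊[θ] K => (x.left, x.right)))

lemma continuous_semidirectProduct_right : Continuous (fun x : N ⋊[θ] K => x.right) :=
  continuous_snd.comp (continuous_induced_dom (f := fun x : N ⋊[θ] K => (x.left, x.right)))

lemma continuous_semidirectProduct_inl : Continuous (SemidirectProduct.inl : N →* N ⋊[θ] K) :=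
  continuous_induced_rng.2 (continuous_id.prodMk continuous_const)

instance t2Space_semidirectProduct [T2Space N] [T2Space K] : T2Space (N ⋊[θ] K) :=
  .of_injective_continuous
    (fun _ _ h => SemidirectProduct.ext (congrArg Prod.fst h) (congrArg Prod.snd h))
    ((continuous_semidirectProduct_left θ).prodMk (continuous_semidirectProduct_right θ))

variable {θ}

lemma isTopologicalGroup_semidirectProduct [IsTopologicalGroup N] [IsTopologicalGroup K]
    (hθ : Continuous fun p : K × N => θ p.1 p.2) : IsTopologicalGroup (N ⋊[θ] K) := by
  have hleft := continuous_semidirectProduct_left θ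
  have hright := continuous_semidirectProduct_right θ
  exact
    { continuous_mul := continuous_induced_rng.2 <|
        ((hleft.comp continuous_fst).mul (hθ.comp
          ((hright.comp continuous_fst).prodMk (hleft.comp continuous_snd)))).prodMk
        ((hright.comp continuous_fst).mul (hright.comp continuous_snd))
      continuous_inv := continuous_induced_rng.2 <|
        (hθ.comp (hright.inv.prodMk hleft.inv)).prodMk hright.inv }

end SemidirectProduct

/-! ### Compact groups of graph automorphisms -/

lemma finite_orbit_of_relIndex_stabilizer_ne_zero {G α : Type*} [Group G] [MulAction G α]
    {K : Subgroup G} {x : α} (h : (MulAction.stabilizer G x).relIndex K ≠ 0) :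
    (MulAction.orbit K x).Finite :=
  Set.finite_of_ncard_ne_zero (MulAction.index_stabilizer K x ▸ h)

open scoped Pointwise in
lemma finite_orbit_mk_of_commensurable {G : Type*} [Group G] {K L : Subgroup G} {g : G}
    (h : (ConjAct.toConjAct g • L).Commensurable K) :
    (MulAction.orbit K (g : G ⧸ L)).Finite := by
  refine finite_orbit_of_relIndex_stabilizer_ne_zero ?_
  have hstab : MulAction.stabilizer G (g : G ⧸ L) = ConjAct.toConjAct g • L := by
    have := MulAction.stabilizer_smul_eq_stabilizer_map_conj g ((1 : G) : G ⧸ L)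
    rwa [MulAction.stabilizer_quotient, MulAction.Quotient.smul_mk, smul_eq_mul, mul_one] at this
  exact hstab ▸ h.1

lemma exists_perm_eventually_eq {S α : Type*} {F : Filter S} [F.NeBot] {f : S → Equiv.Perm α}
    (h : ∀ a, ∃ b, ∀ᶠ s in F, f s a = b) (h' : ∀ a, ∃ b, ∀ᶠ s in F, (f s)⁻¹ a = b) :
    ∃ p : Equiv.Perm α, ∀ a, ∀ᶠ s in F, f s a = p a := by
  choose p hp using h
  choose q hq using h'
  refine ⟨⟨p, q, fun a => ?_, fun a => ?_⟩, hp⟩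
  · obtain ⟨s, h1, h2⟩ := ((hp a).and (hq (p a))).exists
    rw [← h2, ← h1, Equiv.Perm.coe_inv, Equiv.symm_apply_apply]
  · obtain ⟨s, h1, h2⟩ := ((hq a).and (hp (q a))).exists
    rw [← h2, ← h1, Equiv.Perm.coe_inv, Equiv.apply_symm_apply]

lemma exists_eventually_eq_of_finite_image {S α : Type*} {F : Ultrafilter S} {K : Set S}
    (hK : K ∈ F) {f : S → α} (hf : (f '' K).Finite) : ∃ a, ∀ᶠ s in F, f s = a := by
  obtain ⟨a, -, ha⟩ := (F.map f).eq_pure_of_finite_mem hf (image_mem_map hK)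
  have hmem : {a} ∈ F.map f := ha ▸ Ultrafilter.mem_pure.2 rfl
  exact ⟨a, hmem⟩

namespace OGraph

variable {V E : Type*} (X : OGraph V E)

lemma continuous_onV [TopologicalSpace V] [DiscreteTopology V] (v : V) :
    Continuous fun g : X.Aut => g.onV v :=
  continuous_discrete_rng.2 (X.isOpen_onV v)

lemma continuous_onE [TopologicalSpace E] [DiscreteTopology E] (e : E) :
    Continuous fun g : X.Aut => g.onE e :=
  continuous_discrete_rng.2 (X.isOpen_onE e)

lemma image_onV_closure (S : Set X.Aut) (v : V) :
    (fun g : X.Aut => g.onV v) '' closure S = (fun g : X.Aut => g.onV v) '' S := by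
  let _ : TopologicalSpace V := ⊥
  have _ : DiscreteTopology V := ⟨rfl⟩
  exact ((image_closure_subset_closure_image (X.continuous_onV v)).trans_eq
    (closure_discrete _)).antisymm (Set.image_mono subset_closure)

lemma image_onE_closure (S : Set X.Aut) (e : E) :
    (fun g : X.Aut => g.onE e) '' closure S = (fun g : X.Aut => g.onE e) '' S := by
  let _ : TopologicalSpace E := ⊥
  have _ : DiscreteTopology E := ⟨rfl⟩
  exact ((image_closure_subset_closure_image (X.continuous_onE e)).trans_eq
    (closure_discrete _)).antisymm (Set.image_mono subset_closure)

lemma isInducing_onV_onE [TopologicalSpace V] [DiscreteTopology V] [TopologicalSpace E]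
    [DiscreteTopology E] :
    IsInducing fun g : X.Aut => ((g.onV : V → V), (g.onE : E → E)) where
  eq_induced := by
    simp only [instTopologicalSpaceProd, Pi.topologicalSpace, induced_inf, induced_iInf,
      induced_compose, DiscreteTopology.eq_bot (α := V), DiscreteTopology.eq_bot (α := E)]
    rfl

lemma tendsto_aut_nhds_iff {S : Type*} {l : Filter S} {f : S → X.Aut} {g : X.Aut} :
    Tendsto f l (𝓝 g) ↔ (∀ v, ∀ᶠ s in l, (f s).onV v = g.onV v) ∧
      ∀ e, ∀ᶠ s in l, (f s).onE e = g.onE e := by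
  let _ : TopologicalSpace V := ⊥
  have _ : DiscreteTopology V := ⟨rfl⟩
  let _ : TopologicalSpace E := ⊥
  have _ : DiscreteTopology E := ⟨rfl⟩
  simp only [X.isInducing_onV_onE.tendsto_nhds_iff, nhds_prod_eq, tendsto_prod_iff',
    tendsto_pi_nhds, nhds_discrete, tendsto_pure, Function.comp_apply]

instance : T2Space X.Aut := by
  let _ : TopologicalSpace V := ⊥
  have _ : DiscreteTopology V := ⟨rfl⟩
  let _ : TopologicalSpace E := ⊥
  have _ : DiscreteTopology E := ⟨rfl⟩
  refine .of_injective_continuous (fun g h hgh => ?_) X.isInducing_onV_onE.continuous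
  exact Subtype.ext (Prod.ext (DFunLike.coe_injective (congrArg Prod.fst hgh))
    (DFunLike.coe_injective (congrArg Prod.snd hgh)))

lemma exists_le_nhds_aut {F : Filter X.Aut} [F.NeBot]
    (hV : ∀ v, ∃ w, ∀ᶠ g in F, g.onV v = w) (hV' : ∀ v, ∃ w, ∀ᶠ g in F, g⁻¹.onV v = w)
    (hE : ∀ e, ∃ f, ∀ᶠ g in F, g.onE e = f) (hE' : ∀ e, ∃ f, ∀ᶠ g in F, g⁻¹.onE e = f) :
    ∃ g, F ≤ 𝓝 g := by
  obtain ⟨p, hp⟩ := exists_perm_eventually_eq (f := Aut.onV) hV hV'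
  obtain ⟨q, hq⟩ := exists_perm_eventually_eq (f := Aut.onE) hE hE'
  have haut : (p, q) ∈ X.autSubgroup := by
    intro e
    obtain ⟨g, ⟨he, hplus⟩, hbar⟩ := (((hq e).and (hp (X.plus e))).and (hq (X.bar e))).exists
    obtain ⟨hgplus, hgbar⟩ := g.2 e
    exact ⟨by rw [← he, ← hplus]; exact hgplus, by rw [← he, ← hbar]; exact hgbar⟩
  exact ⟨⟨(p, q), haut⟩, X.tendsto_aut_nhds_iff.2 ⟨hp, hq⟩⟩

lemma isCompact_topologicalClosure_of_finite_orbits {Γ : Subgroup X.Aut}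
    (hV : ∀ v, ((fun g : X.Aut => g.onV v) '' Γ).Finite)
    (hE : ∀ e, ((fun g : X.Aut => g.onE e) '' Γ).Finite) :
    IsCompact (Γ.topologicalClosure : Set X.Aut) := by
  refine isCompact_iff_ultrafilter_le_nhds.2 fun F hF => ?_
  have hmem : (Γ.topologicalClosure : Set X.Aut) ∈ F := le_principal_iff.1 hF
  have hinv : (Γ.topologicalClosure : Set X.Aut) ∈ F.map Inv.inv :=
    Ultrafilter.mem_map.2 (mem_of_superset hmem fun g hg =>
      (inv_mem hg : g⁻¹ ∈ Γ.topologicalClosure))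
  have hV' : ∀ v, ((fun g : X.Aut => g.onV v) '' Γ.topologicalClosure).Finite := fun v =>
    (X.image_onV_closure Γ v).symm ▸ hV v
  have hE' : ∀ e, ((fun g : X.Aut => g.onE e) '' Γ.topologicalClosure).Finite := fun e =>
    (X.image_onE_closure Γ e).symm ▸ hE e
  obtain ⟨g, hg⟩ := X.exists_le_nhds_aut (F := F)
    (fun v => exists_eventually_eq_of_finite_image hmem (hV' v))
    (fun v => exists_eventually_eq_of_finite_image hinv (hV' v))
    (fun e => exists_eventually_eq_of_finite_image hmem (hE' e))
    (fun e => exists_eventually_eq_of_finite_image hinv (hE' e))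
  exact ⟨g, Γ.isClosed_topologicalClosure.mem_of_tendsto hg hmem, hg⟩

/-- The group of the automorphisms fixing the vertex `v`. -/
def vertexStabilizer (v : V) : Subgroup X.Aut where
  carrier := {g | g.onV v = v}
  one_mem' := rfl
  mul_mem' := fun {g _} hg hh => (congrArg g.onV hh).trans hg
  inv_mem' := fun {g} hg => g.onV.symm_apply_eq.2 hg.symm

lemma mem_vertexStabilizer {v : V} {g : X.Aut} : g ∈ X.vertexStabilizer v ↔ g.onV v = v := Iff.rfl

lemma isOpen_vertexStabilizer (v : V) : IsOpen (X.vertexStabilizer v : Set X.Aut) :=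
  X.isOpen_onV v v

end OGraph

/-! ### Integral points -/

section IntegralPoints

/-- The inclusion of the lattice `ℤⁿ` of integral points in `ℝⁿ`, both written
multiplicatively. -/
def intVec (n : ℕ) : ZZ n →* RR n :=
  AddMonoidHom.toMultiplicative ((Int.castAddHom ℝ).compLeft (Fin n))

variable {n : ℕ}

lemma toAdd_intVec_apply (a : ZZ n) (i : Fin n) : (intVec n a).toAdd i = a.toAdd i := rfl

lemma eq_one_of_norm_intVec_lt_one {a : ZZ n} (h : ‖(intVec n a).toAdd‖ < 1) : a = 1 := by
  apply Multiplicative.toAdd.injective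
  funext i
  have habs := (norm_le_pi_norm (intVec n a).toAdd i).trans_lt h
  rw [toAdd_intVec_apply, Real.norm_eq_abs, ← Int.cast_abs] at habs
  exact Int.abs_lt_one_iff.1 (by exact_mod_cast habs)

lemma exists_isCompact_forall_exists_mul_intVec_mem (n : ℕ) :
    ∃ C : Set (RR n), IsCompact C ∧ ∀ x, ∃ a, x * intVec n a ∈ C := by
  refine ⟨Multiplicative.toAdd ⁻¹' Set.Icc 0 1, isCompact_Icc (α := Fin n → ℝ), fun x => ?_⟩
  refine ⟨Multiplicative.ofAdd fun i => -⌊x.toAdd i⌋, fun i => ?_, fun i => ?_⟩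
  · simpa [toAdd_intVec_apply] using Int.floor_le (x.toAdd i)
  · have hfract : x.toAdd i - ⌊x.toAdd i⌋ ≤ 1 := (Int.fract_lt_one _).le
    simpa [toAdd_intVec_apply, ← sub_eq_add_neg] using hfract

end IntegralPoints

section StabilizerUnitBall

variable {V E K : Type*} {n : ℕ} [Group K] (X : OGraph V E) (v : V) (θ : K →* MulAut (RR n))

/-- The product of the stabilizer of the vertex `v` with the set of elements of `ℝⁿ ⋊ K` whose
translation part lies in the open unit ball of the sup norm; it is used as a neighbourhood of
`1`. -/
def stabilizerUnitBall : Set (X.Aut × (RR n ⋊[θ] K)) :=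
  {p | p.1 ∈ X.vertexStabilizer v ∧ ‖p.2.left.toAdd‖ < 1}

lemma stabilizerUnitBall_mem_nhds_one [TopologicalSpace K] : stabilizerUnitBall X v θ ∈ 𝓝 1 := by
  have hleft : Continuous fun p : X.Aut × (RR n ⋊[θ] K) => p.2.left.toAdd :=
    continuous_toAdd.comp ((continuous_semidirectProduct_left θ).comp continuous_snd)
  have hone : ‖(1 : RR n).toAdd‖ < 1 := by rw [toAdd_one, norm_zero]; exact one_pos
  exact (((X.isOpen_vertexStabilizer v).preimage continuous_fst).inter
    (isOpen_lt hleft.norm continuous_const)).mem_nhds ⟨one_mem (X.vertexStabilizer v), hone⟩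

end StabilizerUnitBall

namespace ZnGraph

open Matrix
open scoped Pointwise

lemma continuous_glAct_apply {S : Type*} [TopologicalSpace S] {n : ℕ} {M : S → GL (Fin n) ℝ}
    {x : S → RR n} (hM : Continuous M) (hx : Continuous x) :
    Continuous fun s => glAct n (M s) (x s) :=
  continuous_ofAdd.comp ((Units.continuous_val.comp hM).matrix_mulVec (continuous_toAdd.comp hx))

instance (n : ℕ) : IsTopologicalGroup (RR n ⋊[glAct n] GL (Fin n) ℝ) :=
  isTopologicalGroup_semidirectProduct (continuous_glAct_apply continuous_fst continuous_snd)

variable {n : ℕ} {V E : Type*} (𝒢 : ZnGraph n V E) (T : 𝒢.toOGraph.MaxTree)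

/-! ### Commensurability of the vertex groups -/

lemma index_range_edgeHom (e : E) : (𝒢.edgeHom e).range.index = (𝒢.σ e).det.natAbs := by
  have hinj : Function.Injective (Matrix.mulVecLin (𝒢.σ e)) :=
    Matrix.mulVec_injective_of_det_ne_zero (𝒢.det_ne_zero e)
  have hindex := Submodule.natAbs_det_equiv (LinearMap.range (Matrix.mulVecLin (𝒢.σ e)))
    (LinearEquiv.ofInjective _ hinj)
  have hσ : (LinearMap.range (Matrix.mulVecLin (𝒢.σ e))).subtype ∘ₗ AddMonoidHom.toIntLinearMap
      (LinearEquiv.ofInjective _ hinj : (Fin n → ℤ) →+ LinearMap.range (Matrix.mulVecLin (𝒢.σ e)))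
      = Matrix.toLin' (𝒢.σ e) := rfl
  rw [hσ, LinearMap.det_toLin'] at hindex
  exact hindex.symm

lemma commensurable_edgeSub (e : E) :
    (𝒢.edgeSub T e).Commensurable (𝒢.vertSub T (𝒢.plus e)) := by
  constructor
  · have hindex : (𝒢.edgeHom e).range.index ≠ 0 := by
      rw [index_range_edgeHom]
      exact Int.natAbs_ne_zero.2 (𝒢.det_ne_zero e)
    rw [edgeSub, vertSub, MonoidHom.range_comp, MonoidHom.range_eq_map (𝒢.vert T _),
      Subgroup.relIndex_map_map, top_sup_eq, Subgroup.relIndex_top_right]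
    exact ne_zero_of_dvd_ne_zero hindex (Subgroup.index_dvd_of_le le_sup_left)
  · rw [Subgroup.relIndex_eq_one.2 (𝒢.edgeSub_le T e)]
    exact one_ne_zero

lemma conj_edgeSub (e : E) :
    ConjAct.toConjAct (𝒢.stable T e) • 𝒢.edgeSub T e = 𝒢.edgeSub T (𝒢.bar e) := by
  ext x
  rw [Subgroup.mem_pointwise_smul_iff_inv_smul_mem, ← ConjAct.toConjAct_inv,
    ConjAct.toConjAct_smul]
  constructor
  · intro h
    simpa [mul_assoc] using 𝒢.stable_conj_mem T h
  · intro h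
    have hconj := 𝒢.stable_conj_mem T h
    rwa [𝒢.bar_bar, stable_bar] at hconj

lemma commensurable_conj_stable (e : E) :
    (ConjAct.toConjAct (𝒢.stable T e) • 𝒢.vertSub T (𝒢.plus e)).Commensurable
      (𝒢.vertSub T (𝒢.minus e)) := by
  have hconj := (𝒢.commensurable_edgeSub T e).conj (ConjAct.toConjAct (𝒢.stable T e))
  rw [conj_edgeSub] at hconj
  exact hconj.symm.trans (𝒢.commensurable_edgeSub T (𝒢.bar e))

lemma commensurable_vertSub_of_isWalk {v w : V} {p : List E} (hp : 𝒢.IsWalk v p w)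
    (hT : ∀ e ∈ p, e ∈ T.edges) : (𝒢.vertSub T v).Commensurable (𝒢.vertSub T w) := by
  induction p generalizing v with
  | nil => cases hp; exact .refl _
  | cons e p ih =>
    obtain ⟨rfl, hp⟩ := hp
    have hedge := 𝒢.commensurable_conj_stable T e
    rw [𝒢.stable_tree T (hT e List.mem_cons_self), ConjAct.toConjAct_one, one_smul] at hedge
    exact hedge.symm.trans (ih hp fun f hf => hT f (List.mem_cons_of_mem _ hf))

lemma commensurable_vertSub (v w : V) : (𝒢.vertSub T v).Commensurable (𝒢.vertSub T w) :=
  have ⟨hwalk, _, hT⟩ := 𝒢.treePath_spec T v w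
  𝒢.commensurable_vertSub_of_isWalk T hwalk hT

lemma eq_top_of_vert_mem_of_stable_mem {K : Subgroup (𝒢.FundGroup T)}
    (hv : ∀ v g, 𝒢.vert T v g ∈ K) (hs : ∀ e, 𝒢.stable T e ∈ K) : K = ⊤ := by
  let r : 𝒢.FundGroup T →* K :=
    𝒢.lift T (fun v => (𝒢.vert T v).codRestrict K (hv v)) (fun e => ⟨𝒢.stable T e, hs e⟩)
      (fun e g => Subtype.ext (𝒢.stable_conj T e g)) (fun e => Subtype.ext (𝒢.stable_mul_bar T e))
      (fun e he => Subtype.ext (𝒢.stable_tree T he))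
  have hr : K.subtype.comp r = MonoidHom.id _ :=
    𝒢.hom_ext T (by intro v g; simp [r]) (by intro e; simp [r])
  refine (Subgroup.eq_top_iff' K).2 fun x => ?_
  have hx : (r x : 𝒢.FundGroup T) = x := DFunLike.congr_fun hr x
  exact hx ▸ (r x).2

lemma commensurator_vertSub (v : V) :
    Subgroup.Commensurable.commensurator (𝒢.vertSub T v) = ⊤ := by
  refine 𝒢.eq_top_of_vert_mem_of_stable_mem T (fun u a => ?_) (fun e => ?_)
  · rw [← (𝒢.commensurable_vertSub T u v).eq, Subgroup.Commensurable.commensurator_mem_iff]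
    change (MulAut.conj (𝒢.vert T u a) • 𝒢.vertSub T u).Commensurable _
    rw [Subgroup.conj_smul_eq_self_of_mem (show 𝒢.vert T u a ∈ 𝒢.vertSub T u from ⟨a, rfl⟩)]
  · rw [Subgroup.Commensurable.commensurator_mem_iff]
    exact ((𝒢.commensurable_vertSub T v _).conj _).trans
      ((𝒢.commensurable_conj_stable T e).trans (𝒢.commensurable_vertSub T _ v))

lemma commensurable_conj_vertSub (v w : V) (g : 𝒢.FundGroup T) :
    (ConjAct.toConjAct g • 𝒢.vertSub T v).Commensurable (𝒢.vertSub T w) := by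
  have hg : g ∈ Subgroup.Commensurable.commensurator (𝒢.vertSub T v) :=
    𝒢.commensurator_vertSub T v ▸ Subgroup.mem_top g
  exact ((Subgroup.Commensurable.commensurator_mem_iff _ _).1 hg).trans
    (𝒢.commensurable_vertSub T v w)

/-! ### The closure of a vertex group -/

lemma ι_mem_vertexStabilizer_iff {v : V} {γ : 𝒢.FundGroup T} :
    𝒢.ι T γ ∈ (𝒢.cover T).vertexStabilizer (𝒢.mkV T v 1) ↔ γ ∈ 𝒢.vertSub T v := by
  rw [OGraph.mem_vertexStabilizer, ι_onV, mul_one, eq_comm]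
  refine Iff.trans (b := ((1 : 𝒢.FundGroup T) : 𝒢.FundGroup T ⧸ 𝒢.vertSub T v) = γ)
    (Sigma.mk.inj_iff.trans (by simp)) ?_
  rw [QuotientGroup.eq, inv_one, one_mul]

lemma range_ι_inf_vertexStabilizer (v : V) :
    (𝒢.ι T).range ⊓ (𝒢.cover T).vertexStabilizer (𝒢.mkV T v 1) =
      (𝒢.vertSub T v).map (𝒢.ι T) := by
  ext g
  constructor
  · rintro ⟨⟨γ, rfl⟩, hγ⟩
    exact ⟨γ, (𝒢.ι_mem_vertexStabilizer_iff T).1 hγ, rfl⟩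
  · rintro ⟨γ, hγ, rfl⟩
    exact ⟨⟨γ, rfl⟩, (𝒢.ι_mem_vertexStabilizer_iff T).2 hγ⟩

/-- The closure of the vertex group `G_v` in the automorphism group of the universal cover: the
compact factor of a set whose translates by the fundamental group cover `W`. -/
def vertClosure (v : V) : Subgroup (𝒢.cover T).Aut :=
  ((𝒢.vertSub T v).map (𝒢.ι T)).topologicalClosure

lemma isCompact_vertClosure (v : V) : IsCompact (𝒢.vertClosure T v : Set (𝒢.cover T).Aut) := by
  refine (𝒢.cover T).isCompact_topologicalClosure_of_finite_orbits (fun x => ?_) (fun x => ?_)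
  · obtain ⟨w, g, rfl⟩ := 𝒢.mkV_surj T x
    refine ((finite_orbit_mk_of_commensurable
      (𝒢.commensurable_conj_vertSub T w v g)).image (Sigma.mk w)).subset ?_
    rintro _ ⟨_, ⟨γ, hγ, rfl⟩, rfl⟩
    exact ⟨_, ⟨⟨γ, hγ⟩, rfl⟩, rfl⟩
  · obtain ⟨e, g, rfl⟩ := 𝒢.mkE_surj T x
    refine ((finite_orbit_mk_of_commensurable (((𝒢.commensurable_edgeSub T e).conj
      (ConjAct.toConjAct g)).trans (𝒢.commensurable_conj_vertSub T _ v g))).image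
      (Sigma.mk e)).subset ?_
    rintro _ ⟨_, ⟨γ, hγ, rfl⟩, rfl⟩
    exact ⟨_, ⟨⟨γ, hγ⟩, rfl⟩, rfl⟩

lemma vertClosure_le_closureι (v : V) : 𝒢.vertClosure T v ≤ 𝒢.closureι T :=
  Subgroup.topologicalClosure_mono (Subgroup.map_le_range _ _)

lemma vertClosure_le_vertexStabilizer (v : V) :
    𝒢.vertClosure T v ≤ (𝒢.cover T).vertexStabilizer (𝒢.mkV T v 1) :=
  Subgroup.topologicalClosure_minimal _
    (𝒢.range_ι_inf_vertexStabilizer T v ▸ inf_le_right)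
    (Subgroup.isClosed_of_isOpen _ ((𝒢.cover T).isOpen_vertexStabilizer _))

lemma ι_vert_mem_vertClosure (v : V) (a : ZZ n) : 𝒢.ι T (𝒢.vert T v a) ∈ 𝒢.vertClosure T v :=
  subset_closure ⟨_, ⟨a, rfl⟩, rfl⟩

/-! ### The lattice -/

variable (A : 𝒢.toOGraph.Orientation) (v₀ : V)

instance : IsTopologicalGroup (𝒢.SemiH T A v₀) :=
  isTopologicalGroup_semidirectProduct
    (continuous_glAct_apply (continuous_of_discreteTopology.comp continuous_fst) continuous_snd)

lemma τ_self : 𝒢.τ T v₀ v₀ = 1 := by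
  rw [τ, ← 𝒢.eq_treePath T (p := []) rfl List.isChain_nil (by simp)]
  rfl

lemma vertVec_self : 𝒢.vertVec T v₀ v₀ = intVec n := by
  refine MonoidHom.ext fun a => ?_
  simp only [vertVec, τ_self, Units.val_one, Matrix.one_mulVec]
  rfl

lemma μ_vert_base (a : ZZ n) :
    𝒢.μ T v₀ (𝒢.vert T v₀ a) = SemidirectProduct.inl (intVec n a) := by
  rw [μ, lift_vert, vertVec_self, MonoidHom.comp_apply]

lemma ν_vert_base (a : ZZ n) :
    𝒢.ν T A v₀ (𝒢.vert T v₀ a) = SemidirectProduct.inl (intVec n a) :=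
  SemidirectProduct.ext
    (show (𝒢.μ T v₀ _).left = intVec n a by rw [μ_vert_base, SemidirectProduct.left_inl])
    (𝒢.φ_vert T A v₀ a)

lemma φbar_eq_one_of_mem_vertexStabilizer {x : 𝒢.CoverV T} {g : 𝒢.closureι T}
    (hg : g.1 ∈ (𝒢.cover T).vertexStabilizer x) : 𝒢.φbar T A v₀ g = 1 := by
  have hlabel := 𝒢.label_eq T A g.2 (𝒢.mkV T v₀ 1) x
  rwa [(OGraph.mem_vertexStabilizer _).1 hg, mul_inv_cancel] at hlabel

lemma mem_W_iff_of_mem_vertClosure {v : V} {p : (𝒢.cover T).Aut × 𝒢.SemiH T A v₀}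
    (hp : p.1 ∈ 𝒢.vertClosure T v) : p ∈ 𝒢.W T A v₀ ↔ p.2.right = 1 := by
  have hcl := 𝒢.vertClosure_le_closureι T v hp
  have hφ : 𝒢.φbar T A v₀ ⟨p.1, hcl⟩ = 1 :=
    𝒢.φbar_eq_one_of_mem_vertexStabilizer T A v₀ (𝒢.vertClosure_le_vertexStabilizer T v hp)
  exact ⟨fun ⟨_, h⟩ => h.symm.trans hφ, fun h => ⟨hcl, hφ.trans h.symm⟩⟩

lemma range_ι_prod_ν_le_W : ((𝒢.ι T).prod (𝒢.ν T A v₀)).range ≤ 𝒢.W T A v₀ := by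
  rintro _ ⟨γ, rfl⟩
  exact ⟨subset_closure ⟨γ, rfl⟩, 𝒢.φbar_ι T A v₀ γ _⟩

lemma vertClosure_prod_image_inl_subset_W (v : V) (C : Set (RR n)) :
    (𝒢.vertClosure T v : Set (𝒢.cover T).Aut) ×ˢ
      ((SemidirectProduct.inl : RR n →* 𝒢.SemiH T A v₀) '' C) ⊆ 𝒢.W T A v₀ := by
  rintro ⟨g, _⟩ ⟨hg, x, -, rfl⟩
  exact (𝒢.mem_W_iff_of_mem_vertClosure T A v₀ hg).2 rfl

lemma exists_mul_mem_vertClosure_prod {C : Set (RR n)} (hC : ∀ x, ∃ a, x * intVec n a ∈ C)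
    {p : (𝒢.cover T).Aut × 𝒢.SemiH T A v₀} (hp : p ∈ 𝒢.W T A v₀) :
    ∃ q ∈ ((𝒢.ι T).prod (𝒢.ν T A v₀)).range, p * q ∈
      (𝒢.vertClosure T v₀ : Set (𝒢.cover T).Aut) ×ˢ
        ((SemidirectProduct.inl : RR n →* 𝒢.SemiH T A v₀) '' C) := by
  obtain ⟨_, ⟨γ, rfl⟩, hγ⟩ := exists_mul_mem_topologicalClosure_inf
    ((𝒢.cover T).isOpen_vertexStabilizer (𝒢.mkV T v₀ 1)) hp.1
  rw [range_ι_inf_vertexStabilizer] at hγ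
  change p.1 * 𝒢.ι T γ ∈ 𝒢.vertClosure T v₀ at hγ
  set f := (𝒢.ι T).prod (𝒢.ν T A v₀)
  have hright : (p * f γ).2.right = 1 :=
    (𝒢.mem_W_iff_of_mem_vertClosure T A v₀ hγ).1
      (mul_mem hp (𝒢.range_ι_prod_ν_le_W T A v₀ ⟨γ, rfl⟩))
  have hinl : (p * f γ).2 = SemidirectProduct.inl (p * f γ).2.left :=
    SemidirectProduct.ext rfl hright
  obtain ⟨a, ha⟩ := hC (p * f γ).2.left
  refine ⟨f (γ * 𝒢.vert T v₀ a), ⟨_, rfl⟩, ?_⟩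
  rw [map_mul, ← mul_assoc]
  refine ⟨mul_mem hγ (𝒢.ι_vert_mem_vertClosure T v₀ a), _, ha, ?_⟩
  rw [map_mul, ← hinl, ← 𝒢.ν_vert_base T A v₀ a]
  rfl

lemma eq_one_of_ι_prod_μ_mem_stabilizerUnitBall {γ : 𝒢.FundGroup T}
    (hγ : (𝒢.ι T).prod (𝒢.μ T v₀) γ ∈
      stabilizerUnitBall (𝒢.cover T) (𝒢.mkV T v₀ 1) (glAct n)) : γ = 1 := by
  obtain ⟨hι, hμ⟩ : _ ∧ ‖(𝒢.μ T v₀ γ).left.toAdd‖ < 1 := hγ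
  obtain ⟨a, rfl⟩ := (𝒢.ι_mem_vertexStabilizer_iff T).1 hι
  rw [μ_vert_base, SemidirectProduct.left_inl] at hμ
  rw [eq_one_of_norm_intVec_lt_one hμ, map_one]

lemma eq_one_of_ι_prod_ν_mem_stabilizerUnitBall {γ : 𝒢.FundGroup T}
    (hγ : (𝒢.ι T).prod (𝒢.ν T A v₀) γ ∈
      stabilizerUnitBall (𝒢.cover T) (𝒢.mkV T v₀ 1) ((glAct n).comp (𝒢.linH T A v₀))) : γ = 1 :=
  𝒢.eq_one_of_ι_prod_μ_mem_stabilizerUnitBall T v₀ hγ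

lemma isCocompactLattice_range_ι_prod_ν :
    IsCocompactLattice (((𝒢.ι T).prod (𝒢.ν T A v₀)).range.subgroupOf (𝒢.W T A v₀)) := by
  obtain ⟨C, hC, hcover⟩ := exists_isCompact_forall_exists_mul_intVec_mem n
  exact isCocompactLattice_subgroupOf
    (isDiscrete_range_of_forall_mem_imp_eq_one
      (stabilizerUnitBall_mem_nhds_one _ (𝒢.mkV T v₀ 1) _)
      fun _ => 𝒢.eq_one_of_ι_prod_ν_mem_stabilizerUnitBall T A v₀)
    ((𝒢.isCompact_vertClosure T v₀).prod (hC.image (continuous_semidirectProduct_inl _)))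
    (𝒢.vertClosure_prod_image_inl_subset_W T A v₀ v₀ C)
    fun _ => 𝒢.exists_mul_mem_vertClosure_prod T A v₀ hcover

end ZnGraph

end GraphZn

end

open GraphZn ZnGraph in
theorem mainTheorem7_general {V E : Type*} {n : ℕ} (𝒢 : ZnGraph n V E) (T : 𝒢.toOGraph.MaxTree)
    (A : 𝒢.toOGraph.Orientation) (v₀ : V) :
    Function.Injective ((𝒢.ι T).prod (𝒢.ν T A v₀)) ∧
    ((𝒢.ι T).prod (𝒢.ν T A v₀)).range ≤ 𝒢.W T A v₀ ∧
    IsCocompactLattice (((𝒢.ι T).prod (𝒢.ν T A v₀)).range.subgroupOf (𝒢.W T A v₀)) ∧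
    Tendsto ((𝒢.ι T).prod (𝒢.μ T v₀)) cofinite
      (cocompact ((𝒢.cover T).Aut × (RR n ⋊[glAct n] GL (Fin n) ℝ))) := by
  have hν := stabilizerUnitBall_mem_nhds_one (𝒢.cover T) (𝒢.mkV T v₀ 1)
    ((glAct n).comp (𝒢.linH T A v₀))
  have hμ := stabilizerUnitBall_mem_nhds_one (𝒢.cover T) (𝒢.mkV T v₀ 1) (glAct n)
  refine ⟨?_, 𝒢.range_ι_prod_ν_le_W T A v₀, 𝒢.isCocompactLattice_range_ι_prod_ν T A v₀, ?_⟩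
  · exact injective_of_forall_mem_imp_eq_one (mem_of_mem_nhds hν) fun _ =>
      𝒢.eq_one_of_ι_prod_ν_mem_stabilizerUnitBall T A v₀
  · have hone := fun γ => 𝒢.eq_one_of_ι_prod_μ_mem_stabilizerUnitBall T v₀ (γ := γ)
    exact ((𝒢.ι T).prod (𝒢.μ T v₀)).tendsto_coe_cofinite_of_discrete
      (injective_of_forall_mem_imp_eq_one (mem_of_mem_nhds hμ) hone)
      (isDiscrete_range_of_forall_mem_imp_eq_one hμ hone)

theorem mainTheorem7 {V E : Type*} [Finite V] [Finite E] {n : ℕ}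
    (𝒢 : GraphZn.ZnGraph n V E) (T : 𝒢.toOGraph.MaxTree) (A : 𝒢.toOGraph.Orientation) (v₀ : V) :
    Function.Injective ((𝒢.ι T).prod (𝒢.ν T A v₀)) ∧
    ((𝒢.ι T).prod (𝒢.ν T A v₀)).range ≤ 𝒢.W T A v₀ ∧
    GraphZn.IsCocompactLattice
      (((𝒢.ι T).prod (𝒢.ν T A v₀)).range.subgroupOf (𝒢.W T A v₀)) ∧
    Filter.Tendsto ((𝒢.ι T).prod (𝒢.μ T v₀)) Filter.cofinite
      (Filter.cocompact ((𝒢.cover T).Aut ×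
        (GraphZn.RR n ⋊[GraphZn.ZnGraph.glAct n] GL (Fin n) ℝ))) :=
  mainTheorem7_general 𝒢 T A v₀
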